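/- For $\beta\in(0,1)$, $f:(0,\infty)\to\mathbb R$ and $x>0$, let $$({}_{\mathcal H}\mathcal I_-^{\beta}f)(x)=\frac1{\Gamma(\beta)}\int_x^\infty\Big(\log\frac zx\Big)^{\beta-1}\frac{f(z)}{z}\,dz,\qquad ({}_{\mathcal H}\mathcal D_-^{\beta}f)(x)=-x\frac{d}{dx}({}_{\mathcal H}\mathcal I_-^{1-\beta}f)(x)$$ be the right-sided Hadamard fractional integral and derivative. With $K_\alpha=\Gamma(\frac{\alpha+1}2)/\sqrt{\Gamma(\alpha)}$ let ${}_{\mathcal H}\mathcal M_-^\alpha f=K_\alpha\,{}_{\mathcal H}\mathcal D_-^{(1-\alpha)/2}f$ for $\alpha\in(0,1)$ and ${}_{\mathcal H}\mathcal M_-^\alpha f=K_\alpha\,{}_{\mathcal H}\mathcal I_-^{(\alpha-1)/2}f$ for $\alpha\in(1,2)$. Let $L_2(\mathbb R^+)=L_2((0,\infty),dx)$ (real-valued functions), and let $L_{2,\alpha}(\mathbb R^+)$ be the space of functions $f$ for which ${}_{\mathcal H}\mathcal M_-^\alpha f$ exists (the integrals converge and, for $\alpha<1$, the derivative exists a.e.)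 and belongs to $L_2(\mathbb R^+)$, with $\|f\|_{L_{2,\alpha}}=\|{}_{\mathcal H}\mathcal M_-^\alpha f\|_{L_2(\mathbb R^+)}$. **Theorem.** Let $\alpha\in(0,1)\cup(1,2)$. (1) For all $0\le a<b$ one has $1_{(a,b)}\in L_{2,\alpha}(\mathbb R^+)$, and the linear span of $\{{}_{\mathcal H}\mathcal M_-^\alpha 1_{(a,b)}:0\le a<b\}$ is dense in $L_2(\mathbb R^+)$; the span of the subset given by $0<a<b$ is already dense. (2) Consequently the Wiener integral with respect to the Hadamard fractional Brownian motion is well defined on $L_{2,\alpha}(\mathbb R^+)$. A step function is a function $\varphi=\sum_{k=1}^n a_k1_{[t_{k-1},t_k)}$ with $0\le t_0<\dots<t_n$ and $a_k\in\mathbb R$. For every $f\in L_{2,\alpha}(\mathbb R^+)$ there are step functions $\varphi_n\in L_{2,\alpha}(\mathbb R^+)$ with $\|\varphi_n-f\|_{L_{2,\alpha}}\to0$. Let moreover $B$ be a standard Brownian motion on a probability space $(\Omega,P)$ and $B^{\mathcal H}_\alpha(t)=\frac1{\sqrt{\Gamma(\alpha)}}\int_0^t(\log\frac ts)^{(\alpha-1)/2}\,dB(s)$,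 $t\ge0$. Then there is a unique $I_\alpha(f)\in L_2(P)$ such that $I_\alpha(f)=\int_0^\infty({}_{\mathcal H}\mathcal M_-^\alpha f)(s)\,dB(s)$ and such that, for every sequence of step functions $\varphi_n$ with $\|\varphi_n-f\|_{L_{2,\alpha}}\to0$, the elementary integrals $\sum_k a_k\,(B^{\mathcal H}_\alpha(t_k)-B^{\mathcal H}_\alpha(t_{k-1}))$ of $\varphi_n$ converge to $I_\alpha(f)$ in $L_2(P)$. -/

import Mathlib

open MeasureTheory ProbabilityTheory Filter Topology Set
open scoped NNReal ENNReal

noncomputable section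

/-- Lebesgue measure on the positive half-line `(0, ∞)`. -/
def volPos : Measure ℝ := volume.restrict (Ioi (0 : ℝ))

/-- The integrand of the right-sided Hadamard integral of order `β` at the point `x`, as a function
of the integration variable `z > x`. -/
def hadamardIntegrand (β : ℝ) (f : ℝ → ℝ) (x z : ℝ) : ℝ :=
  Real.log (z / x) ^ (β - 1) * (f z / z)

/-- The right-sided Hadamard fractional integral of order `β > 0`,
`x ↦ (1 / Γ(β)) ∫_x^∞ (log (z / x))^(β - 1) f(z) dz / z`, for `x > 0`. -/
def hadamardIntegral (β : ℝ) (f : ℝ → ℝ) (x : ℝ) : ℝ :=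
  1 / Real.Gamma β * ∫ z in Ioi x, hadamardIntegrand β f x z

/-- The right-sided Hadamard fractional derivative of order `β ∈ (0, 1)` at `x > 0`,
`- x (d/dx)` applied to the Hadamard integral of order `1 - β`.  (For general non-integer `β` the
operator `- x (d/dx)` is applied `⌊β⌋ + 1` times to the integral of order `⌊β⌋ + 1 - β`;
only orders in `(0, 1/2)` occur below.) -/
def hadamardDeriv (β : ℝ) (f : ℝ → ℝ) (x : ℝ) : ℝ :=
  -x * deriv (hadamardIntegral (1 - β) f) x

/-- The normalising constant `K_α = Γ((α + 1) / 2) / √Γ(α)`. -/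
def hadamardConst (α : ℝ) : ℝ :=
  Real.Gamma ((α + 1) / 2) / √(Real.Gamma α)

/-- The operator `M^α_-`, for `α ∈ (0, 2)`: the Hadamard derivative of order `(1 - α) / 2` if
`α < 1`, the identity if `α = 1`, the Hadamard integral of order `(α - 1) / 2` if `α > 1`. -/
def hadamardM (α : ℝ) (f : ℝ → ℝ) (x : ℝ) : ℝ :=
  if α < 1 then hadamardConst α * hadamardDeriv ((1 - α) / 2) f x
  else if α = 1 then f x
  else hadamardConst α * hadamardIntegral ((α - 1) / 2) f x

/-- `M^α_- f` is genuinely defined: the integrals in its definition converge and the derivative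
exists almost everywhere, so that no default value of `∫` or `deriv` is involved. -/
def HadamardDefined (α : ℝ) (f : ℝ → ℝ) : Prop :=
  if α < 1 then
    (∀ x : ℝ, 0 < x →
      IntegrableOn (hadamardIntegrand (1 - (1 - α) / 2) f x) (Ioi x) volume) ∧
    ∀ᵐ x ∂volPos, DifferentiableAt ℝ (hadamardIntegral (1 - (1 - α) / 2) f) x
  else if α = 1 then True
  else ∀ᵐ x ∂volPos, IntegrableOn (hadamardIntegrand ((α - 1) / 2) f x) (Ioi x) volume

/-- Membership in `L_{2,α}(ℝ⁺)`: the function `M^α_- f` exists and lies in `L₂(ℝ⁺)`. -/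
structure MemHadamardL2 (α : ℝ) (f : ℝ → ℝ) : Prop where
  defined : HadamardDefined α f
  memLp : MemLp (hadamardM α f) 2 volPos

/-- The indicator function of the open interval `(a, b)`. -/
def indIoo (a b : ℝ) : ℝ → ℝ := (Ioo a b).indicator (fun _ => 1)

/-- A step function on `ℝ⁺`: a grid `0 ≤ t 0 < t 1 < ... < t n` and the value `a k` on the
`k`-th interval `[t k, t (k + 1))`. -/
structure StepFunction where
  n : ℕ
  t : Fin (n + 1) → ℝ≥0
  strictMono : StrictMono t
  a : Fin n → ℝ

/-- The function `x ↦ ∑ k, a k * 1_{[t k, t (k + 1))}(x)`. -/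
def StepFunction.toFun (φ : StepFunction) (x : ℝ) : ℝ :=
  ∑ k : Fin φ.n,
    φ.a k * (Ico (φ.t k.castSucc : ℝ) (φ.t k.succ : ℝ)).indicator (fun _ => (1 : ℝ)) x

/-- The elementary stochastic integral `∑ k, a k * (X (t (k + 1)) - X (t k))` of a step function
with respect to a process `X`. -/
def StepFunction.integral {Ω : Type*} (φ : StepFunction) (X : ℝ≥0 → Ω → ℝ) (ω : Ω) : ℝ :=
  ∑ k : Fin φ.n, φ.a k * (X (φ.t k.succ) ω - X (φ.t k.castSucc) ω)

/-- `Y` is (a version of) the Wiener integral `∫ g dB` over `ℝ⁺` of `g ∈ L₂(ℝ⁺)`: the limit in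
`L₂(P)` of the elementary integrals of step functions converging to `g` in `L₂(ℝ⁺)`. -/
structure IsWienerIntegral {Ω : Type*} [MeasurableSpace Ω] (P : Measure Ω) (B : ℝ≥0 → Ω → ℝ)
    (g : ℝ → ℝ) (Y : Ω → ℝ) : Prop where
  memLp_integrand : MemLp g 2 volPos
  memLp : MemLp Y 2 P
  limit : ∃ φ : ℕ → StepFunction,
    Tendsto (fun n => eLpNorm (fun x => (φ n).toFun x - g x) 2 volPos) atTop (𝓝 0) ∧
    Tendsto (fun n => eLpNorm (fun ω => (φ n).integral B ω - Y ω) 2 P) atTop (𝓝 0)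

/-- `X` is the Hadamard fractional Brownian motion of index `α` driven by the Brownian motion `B`:
`X t = Γ(α)^(-1/2) ∫_0^t (log (t / s))^((α - 1) / 2) dB(s)` for every `t ≥ 0`. -/
def IsHadamardFBM {Ω : Type*} [MeasurableSpace Ω] (P : Measure Ω) (α : ℝ)
    (B X : ℝ≥0 → Ω → ℝ) : Prop :=
  ∀ t : ℝ≥0, IsWienerIntegral P B
    ((Ioo (0 : ℝ) t).indicator
      (fun s => 1 / √(Real.Gamma α) * Real.log (t / s) ^ ((α - 1) / 2))) (X t)

/-- The sequence of step functions `φ n` converges to `f` in the (semi)norm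
`‖h‖ = ‖M^α_- h‖_{L₂(ℝ⁺)}` of `L_{2,α}(ℝ⁺)`. -/
def TendstoHadamardL2 (α : ℝ) (φ : ℕ → StepFunction) (f : ℝ → ℝ) : Prop :=
  Tendsto (fun n => eLpNorm (hadamardM α (fun x => (φ n).toFun x - f x)) 2 volPos) atTop (𝓝 0)

end

/-! Put `γ = (α - 1) / 2`, which lies in `(-1/2, 1/2)`. In both regimes the constant `K_α` cancels
the Gamma factors, and `M^α_-` sends `1_{(a,b)}` to `v b - v a`, where `v t = Γ(α)^(-1/2) (log (t /
·))_+ ^ γ` (`hadamardM_indIio`). Substituting `s = t e^(-u)` gives `∫_0^t (log (t / s))^(2γ) ds = t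
Γ(2γ + 1)`, so `v t` is in `L₂` and tends to `0` with `t`.

Density: let `h` be orthogonal to all increments of `v` away from zero. Letting the left endpoint
tend to `0`, `h` is orthogonal to every `v b`. Averaging over `b` against `b⁻¹ (log (c / b))^(-γ)`
is Abel's inversion: a Beta integral turns the power `γ` into the power `1`, and `h` is orthogonal
to `(log (c / ·))_+`. Differentiating in `log c` gives `∫_0^c h = 0` for all `c > 0`, and Lebesgue
differentiation gives `h = 0` (`eq_zero_of_forall_integral_logPow_eq_zero`).

Wiener integral: `1_{(0,t)}` and `B t` have the same Gram matrix `min s t`, so there is a continuous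
linear `U` with `U 1_{(0,t)} = B t`, and being a Wiener integral means lying on the graph of `U`
(`isWienerIntegral_iff`). The process is then `X t = U (v t)`, and convergence in `L_{2,α}` is `L₂`
convergence of step sums of `v`. Approximation follows from density, and convergence of the
elementary integrals from continuity of `U`. -/

noncomputable section

/-! ### Step sums with values in a vector space -/

/-- The sum `∑ k, a k • (v (t (k + 1)) - v (t k))` of a step function against a vector-valued
function `v` of time. -/
def StepFunction.sum {E : Type*} [AddCommGroup E] [Module ℝ E] (φ : StepFunction)
    (v : ℝ≥0 → E) : E :=
  ∑ k : Fin φ.n, φ.a k • (v (φ.t k.succ) - v (φ.t k.castSucc))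

theorem StepFunction.map_sum {E F : Type*} [AddCommGroup E] [Module ℝ E] [AddCommGroup F]
    [Module ℝ F] (L : E →ₗ[ℝ] F) (φ : StepFunction) (v : ℝ≥0 → E) :
    L (φ.sum v) = φ.sum fun t => L (v t) := by
  simp [StepFunction.sum, _root_.map_sum]

theorem Fin.sum_ite_castSucc_lt_sub {E : Type*} [AddCommGroup E] {n : ℕ} (w : Fin (n + 1) → E)
    (i : Fin (n + 1)) :
    ∑ k : Fin n, (if k.castSucc < i then w k.succ - w k.castSucc else 0) = w i - w 0 := by
  induction n with
  | zero => simp [Fin.fin_one_eq_zero i]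
  | succ n ih =>
    induction i using Fin.lastCases with
    | last =>
      rw [Fin.sum_univ_castSucc]
      have := ih (fun j => w j.castSucc) (Fin.last n)
      simp only [Fin.castSucc_lt_last, if_true, Fin.succ_last] at this ⊢
      simp only [Fin.succ_castSucc]
      rw [this]
      simp
    | cast i =>
      rw [Fin.sum_univ_castSucc]
      have := ih (fun j => w j.castSucc) i
      simp only [Fin.castSucc_lt_castSucc_iff, Fin.succ_castSucc] at this ⊢
      rw [this, if_neg (not_lt.2 (Fin.le_last i))]
      simp

/-- Abel summation: since `v 0 = 0`, each `v (t i)` is the sum of the increments before it, so the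
`k`-th increment collects the coefficients of all later grid points. -/
theorem exists_stepFunction_sum_eq_of_mem_span {E : Type*} [AddCommGroup E] [Module ℝ E]
    {v : ℝ≥0 → E} (hv : v 0 = 0) {g : E} (hg : g ∈ Submodule.span ℝ (range v)) :
    ∃ φ : StepFunction, φ.sum v = g := by
  classical
  obtain ⟨c, rfl⟩ := Finsupp.mem_span_range_iff_exists_finsupp.1 hg
  -- Adding `0` makes the grid nonempty and forces it to start where `v` vanishes.
  set S : Finset ℝ≥0 := insert 0 c.support with hS
  obtain ⟨n, hn⟩ : ∃ n, S.card = n + 1 :=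
    Nat.exists_eq_succ_of_ne_zero (Finset.card_ne_zero_of_mem (Finset.mem_insert_self _ _))
  let t : Fin (n + 1) ↪o ℝ≥0 := S.orderEmbOfFin hn
  have ht0 : t 0 = 0 := by
    have : (0 : ℝ≥0) ∈ Set.range (S.orderEmbOfFin hn) := by
      rw [Finset.range_orderEmbOfFin]; simp [hS]
    obtain ⟨i, hi⟩ := this
    refine le_antisymm ?_ (zero_le)
    rw [← hi]
    exact t.monotone (Fin.zero_le i)
  have hsum : (c.sum fun i a => a • v i) = ∑ i : Fin (n + 1), c (t i) • v (t i) := by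
    rw [Finsupp.sum_of_support_subset c (s := S) (Finset.subset_insert _ _) _ (by simp),
      ← Finset.map_orderEmbOfFin_univ S hn, Finset.sum_map]
    rfl
  refine ⟨⟨n, t, t.strictMono, fun k => ∑ i, if k.castSucc < i then c (t i) else 0⟩, ?_⟩
  rw [hsum]
  simp only [StepFunction.sum, Finset.sum_smul]
  rw [Finset.sum_comm]
  refine Finset.sum_congr rfl fun i _ => ?_
  have := Fin.sum_ite_castSucc_lt_sub (fun j => v (t j)) i
  simp only [ht0, hv, sub_zero] at this
  rw [← this, Finset.smul_sum]
  refine Finset.sum_congr rfl fun k _ => ?_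
  split_ifs <;> simp

theorem exists_stepFunction_tendsto {E : Type*} [NormedAddCommGroup E] [NormedSpace ℝ E]
    {v : ℝ≥0 → E} (hv : v 0 = 0) (hd : Dense (Submodule.span ℝ (range v) : Set E)) (g : E) :
    ∃ φ : ℕ → StepFunction, Tendsto (fun n => (φ n).sum v) atTop (𝓝 g) := by
  obtain ⟨u, hu, hlim⟩ := mem_closure_iff_seq_limit.1 (hd g)
  choose φ hφ using fun n => exists_stepFunction_sum_eq_of_mem_span hv (hu n)
  exact ⟨φ, by simpa [hφ] using hlim⟩

/-! ### Linear extension from equal Gram matrices -/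

section Isometry

variable {ι E F : Type*} [NormedAddCommGroup E] [InnerProductSpace ℝ E]
  [NormedAddCommGroup F] [InnerProductSpace ℝ F]

theorem norm_linearCombination_eq_of_inner_eq {e : ι → E} {b : ι → F}
    (h : ∀ i j, inner ℝ (e i) (e j) = inner ℝ (b i) (b j)) (c : ι →₀ ℝ) :
    ‖Finsupp.linearCombination ℝ b c‖ = ‖Finsupp.linearCombination ℝ e c‖ := by
  have : inner ℝ (Finsupp.linearCombination ℝ b c) (Finsupp.linearCombination ℝ b c)
      = inner ℝ (Finsupp.linearCombination ℝ e c) (Finsupp.linearCombination ℝ e c) := by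
    simp only [Finsupp.linearCombination_apply, Finsupp.sum, sum_inner, inner_sum, inner_smul_left,
      inner_smul_right, h]
  rw [real_inner_self_eq_norm_sq, real_inner_self_eq_norm_sq] at this
  exact (sq_eq_sq₀ (norm_nonneg _) (norm_nonneg _)).1 this

/-- Equal Gram matrices give equal norms of corresponding combinations, so `e i ↦ b i` is well
defined and bounded on a dense subspace. -/
theorem exists_continuousLinearMap_of_inner_eq [CompleteSpace F] {e : ι → E} {b : ι → F}
    (h : ∀ i j, inner ℝ (e i) (e j) = inner ℝ (b i) (b j))
    (hd : Dense (Submodule.span ℝ (range e) : Set E)) :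
    ∃ U : E →L[ℝ] F, ∀ i, U (e i) = b i := by
  have hn : ∀ c, ‖Finsupp.linearCombination ℝ b c‖ ≤ 1 * ‖Finsupp.linearCombination ℝ e c‖ :=
    fun c => by rw [one_mul, norm_linearCombination_eq_of_inner_eq h]
  have hr : DenseRange (Finsupp.linearCombination ℝ e) := by
    rw [DenseRange, ← LinearMap.coe_range, Finsupp.range_linearCombination]
    exact hd
  refine ⟨(Finsupp.linearCombination ℝ b).extendOfNorm (Finsupp.linearCombination ℝ e),
    fun i => ?_⟩
  simpa using LinearMap.extendOfNorm_eq hr ⟨1, hn⟩ (Finsupp.single i 1)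

end Isometry

/-! ### Passing between `L₂` classes and functions -/

theorem coeFn_stepFunction_sum {X : Type*} [MeasurableSpace X] {μ : Measure X}
    {v : ℝ≥0 → Lp ℝ 2 μ} {w : ℝ≥0 → X → ℝ} (h : ∀ t, v t =ᵐ[μ] w t) (φ : StepFunction) :
    (φ.sum v : Lp ℝ 2 μ) =ᵐ[μ] φ.integral w := by
  have h1 : ((φ.sum v : Lp ℝ 2 μ) : X → ℝ) =ᵐ[μ]
      ∑ k : Fin φ.n, ⇑(φ.a k • (v (φ.t k.succ) - v (φ.t k.castSucc))) :=
    Lp.coeFn_finsetSum _ _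
  have h2 : ∀ k : Fin φ.n, ∀ᵐ x ∂μ, (φ.a k • (v (φ.t k.succ) - v (φ.t k.castSucc)) : Lp ℝ 2 μ) x
      = φ.a k * (w (φ.t k.succ) x - w (φ.t k.castSucc) x) := fun k => by
    filter_upwards [Lp.coeFn_smul (φ.a k) (v (φ.t k.succ) - v (φ.t k.castSucc)),
      Lp.coeFn_sub (v (φ.t k.succ)) (v (φ.t k.castSucc)), h (φ.t k.succ), h (φ.t k.castSucc)]
      with x hx1 hx2 hx3 hx4
    rw [hx1, Pi.smul_apply, hx2, Pi.sub_apply, hx3, hx4, smul_eq_mul]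
  filter_upwards [h1, ae_all_iff.2 h2] with x hx hx2
  rw [hx, Finset.sum_apply, StepFunction.integral]
  exact Finset.sum_congr rfl fun k _ => hx2 k

theorem tendsto_eLpNorm_sub_iff {X : Type*} [MeasurableSpace X] {μ : Measure X}
    {u : ℕ → Lp ℝ 2 μ} {g : Lp ℝ 2 μ} {u' : ℕ → X → ℝ} (h : ∀ n, u n - g =ᵐ[μ] u' n) :
    Tendsto (fun n => eLpNorm (u' n) 2 μ) atTop (𝓝 0) ↔ Tendsto u atTop (𝓝 g) := by
  rw [tendsto_iff_edist_tendsto_0]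
  refine tendsto_congr fun n => ?_
  rw [Lp.edist_def]
  refine eLpNorm_congr_ae ?_
  exact (h n).symm.trans (Lp.coeFn_sub _ _)

theorem coeFn_sub_ae_eq {X : Type*} [MeasurableSpace X] {μ : Measure X}
    {f g : Lp ℝ 2 μ} {f' g' : X → ℝ} (hf : f =ᵐ[μ] f') (hg : g =ᵐ[μ] g') :
    ⇑(f - g) =ᵐ[μ] fun x => f' x - g' x := by
  filter_upwards [Lp.coeFn_sub f g, hf, hg] with x h1 h2 h3
  rw [h1, Pi.sub_apply, h2, h3]

/-! ### Powers of the logarithm and their `L₂` norms -/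

/-- The function `s ↦ (log (t / s))^γ` on `(0, t)`, extended by zero. -/
def logPow (γ t : ℝ) : ℝ → ℝ :=
  (Ioo (0 : ℝ) t).indicator fun s => Real.log (t / s) ^ γ

theorem measurable_logPow_uncurry (γ : ℝ) : Measurable fun p : ℝ × ℝ => logPow γ p.1 p.2 := by
  have hS : MeasurableSet {p : ℝ × ℝ | 0 < p.2 ∧ p.2 < p.1} :=
    (measurableSet_lt measurable_const measurable_snd).inter
      (measurableSet_lt measurable_snd measurable_fst)
  have : (fun p : ℝ × ℝ => logPow γ p.1 p.2) =
      {p : ℝ × ℝ | 0 < p.2 ∧ p.2 < p.1}.indicator fun p => Real.log (p.1 / p.2) ^ γ := by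
    ext p
    simp only [logPow, indicator, mem_Ioo, mem_ofPred_eq]
  rw [this]
  exact Measurable.indicator (by fun_prop) hS

theorem measurable_logPow (γ t : ℝ) : Measurable (logPow γ t) :=
  (measurable_logPow_uncurry γ).comp (measurable_const.prodMk measurable_id)

theorem logPow_of_mem {γ t s : ℝ} (h : s ∈ Ioo 0 t) : logPow γ t s = Real.log (t / s) ^ γ :=
  indicator_of_mem h _

theorem logPow_of_le {γ t s : ℝ} (h : t ≤ s) : logPow γ t s = 0 :=
  indicator_of_notMem (fun hs => (not_lt.2 h) hs.2) _

theorem log_div_pos {t s : ℝ} (h : s ∈ Ioo 0 t) : 0 < Real.log (t / s) :=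
  Real.log_pos ((one_lt_div h.1).2 h.2)

theorem logPow_nonneg (γ t s : ℝ) : 0 ≤ logPow γ t s :=
  indicator_nonneg (fun _ hs => Real.rpow_nonneg (log_div_pos hs).le _) s

theorem logPow_sq (γ t s : ℝ) : logPow γ t s ^ 2 = logPow (2 * γ) t s := by
  by_cases h : s ∈ Ioo 0 t
  · rw [logPow_of_mem h, logPow_of_mem h, ← Real.rpow_natCast, ← Real.rpow_mul (log_div_pos h).le]
    congr 1
    push_cast
    ring
  · simp [logPow, indicator_of_notMem h]

theorem logPow_zero_right (γ : ℝ) : logPow γ 0 = 0 := by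
  ext s
  simp [logPow]

theorem image_mul_exp_neg_Ioi {t : ℝ} (ht : 0 < t) :
    (fun u : ℝ => t * Real.exp (-u)) '' Ioi 0 = Ioo 0 t := by
  ext x
  constructor
  · rintro ⟨u, hu, rfl⟩
    refine ⟨by positivity, ?_⟩
    have : Real.exp (-u) < 1 := Real.exp_lt_one_iff.2 (neg_lt_zero.2 hu)
    nlinarith
  · intro hx
    refine ⟨Real.log (t / x), log_div_pos hx, ?_⟩
    have := hx.1
    simp only
    rw [← Real.log_inv, Real.exp_log (by positivity)]
    field_simp

/-- The substitution `s = t e^(-u)` turns this into `t` times Euler's integral for Gamma. -/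
theorem integrableOn_and_integral_log_div_rpow {p t : ℝ} (hp : -1 < p) (ht : 0 < t) :
    IntegrableOn (fun s => Real.log (t / s) ^ p) (Ioo 0 t) ∧
      ∫ s in Ioo 0 t, Real.log (t / s) ^ p = t * Real.Gamma (p + 1) := by
  have hd : ∀ u ∈ Ioi (0 : ℝ), HasDerivWithinAt (fun u : ℝ => t * Real.exp (-u))
      (-(t * Real.exp (-u))) (Ioi 0) u := fun u _ => by
    have := (((hasDerivAt_id u).neg.exp).const_mul t).hasDerivWithinAt (s := Ioi 0)
    simpa using this
  have hinj : InjOn (fun u : ℝ => t * Real.exp (-u)) (Ioi 0) := fun u _ v _ h => by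
    have := Real.exp_injective (mul_left_cancel₀ ht.ne' h)
    linarith
  have heq : EqOn (fun u => |-(t * Real.exp (-u))| • Real.log (t / (t * Real.exp (-u))) ^ p)
      (fun u => t * (Real.exp (-u) * u ^ (p + 1 - 1))) (Ioi 0) := fun u _ => by
    have h1 : t / (t * Real.exp (-u)) = Real.exp u := by
      rw [Real.exp_neg]; field_simp
    simp only [h1, Real.log_exp, abs_neg, abs_of_pos (mul_pos ht (Real.exp_pos _)), smul_eq_mul]
    rw [add_sub_cancel_right, mul_assoc]
  constructor
  · rw [← image_mul_exp_neg_Ioi ht, integrableOn_image_iff_integrableOn_abs_deriv_smul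
      measurableSet_Ioi hd hinj, integrableOn_congr_fun heq measurableSet_Ioi]
    exact (Real.GammaIntegral_convergent (by linarith)).const_mul t
  · rw [← image_mul_exp_neg_Ioi ht, integral_image_eq_integral_abs_deriv_smul
      measurableSet_Ioi hd hinj, setIntegral_congr_fun measurableSet_Ioi heq,
      integral_const_mul, Real.Gamma_eq_integral (by linarith)]

theorem integrable_logPow {p : ℝ} (hp : -1 < p) (t : ℝ) : Integrable (logPow p t) volPos := by
  rcases le_or_gt t 0 with ht | ht
  · simp [logPow, Ioo_eq_empty (not_lt.2 ht)]
  · rw [logPow, integrable_indicator_iff measurableSet_Ioo, volPos, IntegrableOn,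
      Measure.restrict_restrict measurableSet_Ioo,
      inter_eq_self_of_subset_left Ioo_subset_Ioi_self]
    exact (integrableOn_and_integral_log_div_rpow hp ht).1

theorem integral_logPow {p t : ℝ} (hp : -1 < p) (ht : 0 ≤ t) :
    ∫ s, logPow p t s ∂volPos = t * Real.Gamma (p + 1) := by
  rcases ht.eq_or_lt with rfl | ht
  · simp [logPow_zero_right]
  · rw [logPow, integral_indicator measurableSet_Ioo, volPos,
      Measure.restrict_restrict measurableSet_Ioo,
      inter_eq_self_of_subset_left Ioo_subset_Ioi_self]
    exact (integrableOn_and_integral_log_div_rpow hp ht).2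

theorem memLp_logPow {γ : ℝ} (hγ : -(1 / 2) < γ) (t : ℝ) : MemLp (logPow γ t) 2 volPos := by
  rw [memLp_two_iff_integrable_sq (measurable_logPow γ t).aestronglyMeasurable]
  simp_rw [logPow_sq]
  exact integrable_logPow (by linarith) t

theorem norm_toLp_logPow {γ t : ℝ} (hγ : -(1 / 2) < γ) (ht : 0 ≤ t) :
    ‖(memLp_logPow hγ t).toLp‖ ^ 2 = t * Real.Gamma (2 * γ + 1) := by
  rw [← real_inner_self_eq_norm_sq, L2.inner_def, ← integral_logPow (by linarith) ht]
  refine integral_congr_ae ?_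
  filter_upwards [(memLp_logPow hγ t).coeFn_toLp] with x hx
  simp [hx, ← logPow_sq]

/-! ### Abel inversion: from the power `γ` to the power `1` -/

theorem image_mul_exp_Ioo {x c : ℝ} (hx : x ∈ Ioo 0 c) :
    (fun s : ℝ => x * Real.exp (s * Real.log (c / x))) '' Ioo 0 1 = Ioo x c := by
  have hT := log_div_pos hx
  have hx0 := hx.1
  have hc0 : 0 < c := hx.1.trans hx.2
  ext b
  constructor
  · rintro ⟨s, hs, rfl⟩
    have h1 : 1 < Real.exp (s * Real.log (c / x)) := Real.one_lt_exp_iff.2 (mul_pos hs.1 hT)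
    have h2 : Real.exp (s * Real.log (c / x)) < c / x := by
      rw [← Real.lt_log_iff_exp_lt (by positivity)]
      nlinarith [hs.2]
    refine ⟨by simp only; nlinarith, ?_⟩
    rw [lt_div_iff₀ hx0] at h2
    simp only; linarith
  · intro hb
    have hb0 : 0 < b := hx0.trans hb.1
    have h1 := log_div_pos (t := b) ⟨hx0, hb.1⟩
    refine ⟨Real.log (b / x) / Real.log (c / x), ⟨by positivity, ?_⟩, ?_⟩
    · rw [div_lt_one hT]
      exact Real.log_lt_log (by positivity) (by gcongr; exact hb.2)
    · simp only
      rw [div_mul_cancel₀ _ hT.ne', Real.exp_log (by positivity)]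
      field_simp

theorem integrableOn_rpow_mul_one_sub_rpow {γ : ℝ} (h1 : -1 < γ) (h2 : γ < 1) :
    IntegrableOn (fun s : ℝ => s ^ γ * (1 - s) ^ (-γ)) (Ioo 0 1) := by
  have := Complex.betaIntegral_convergent (u := ((γ + 1 : ℝ) : ℂ)) (v := ((1 - γ : ℝ) : ℂ))
    (by simp; linarith) (by simp; linarith)
  rw [intervalIntegrable_iff_integrableOn_Ioo_of_le zero_le_one] at this
  refine IntegrableOn.congr_fun this.norm (fun s hs => ?_) measurableSet_Ioo
  have e1 : ((1 : ℂ) - (s : ℂ)) = ((1 - s : ℝ) : ℂ) := by push_cast; ring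
  simp only [e1, norm_mul]
  rw [Complex.norm_cpow_eq_rpow_re_of_pos hs.1, Complex.norm_cpow_eq_rpow_re_of_pos
    (sub_pos.2 hs.2)]
  simp

/-- The value `∫_0^1 s^γ (1 - s)^(-γ) ds` of the Beta integral. -/
def betaConst (γ : ℝ) : ℝ := ∫ s in Ioo (0 : ℝ) 1, s ^ γ * (1 - s) ^ (-γ)

theorem betaConst_pos {γ : ℝ} (h1 : -1 < γ) (h2 : γ < 1) : 0 < betaConst γ := by
  have hpos : ∀ s ∈ Ioo (0 : ℝ) 1, 0 < s ^ γ * (1 - s) ^ (-γ) := fun s hs =>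
    mul_pos (Real.rpow_pos_of_pos hs.1 _) (Real.rpow_pos_of_pos (sub_pos.2 hs.2) _)
  rw [betaConst, setIntegral_pos_iff_support_of_nonneg_ae
    (ae_restrict_of_forall_mem measurableSet_Ioo fun s hs => (hpos s hs).le)
    (integrableOn_rpow_mul_one_sub_rpow h1 h2)]
  have : Function.support (fun s : ℝ => s ^ γ * (1 - s) ^ (-γ)) ∩ Ioo 0 1 = Ioo 0 1 :=
    inter_eq_self_of_subset_right fun s hs => (hpos s hs).ne'
  rw [this]
  simp

/-- The kernel through which `(log (c / x))_+` is a mixture of the functions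
`(log (b / x))_+ ^ γ`, `b < c`. -/
def abelKernel (γ c b x : ℝ) : ℝ := b⁻¹ * logPow (-γ) c b * logPow γ b x

theorem abelKernel_eq_indicator {γ c x : ℝ} (hx : 0 < x) :
    (fun b => abelKernel γ c b x) =
      (Ioo x c).indicator fun b => b⁻¹ * Real.log (c / b) ^ (-γ) * Real.log (b / x) ^ γ := by
  ext b
  by_cases hb : b ∈ Ioo x c
  · rw [indicator_of_mem hb, abelKernel, logPow_of_mem ⟨hx.trans hb.1, hb.2⟩,
      logPow_of_mem ⟨hx, hb.1⟩]
  · rw [indicator_of_notMem hb, abelKernel]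
    rcases le_or_gt b x with h | h
    · rw [logPow_of_le h, mul_zero]
    · rw [logPow_of_le (not_lt.1 fun h' => hb ⟨h, h'⟩)]
      simp

/-- With `T = log (c / x)` and `b = x e^(sT)`, the two logarithms are `sT` and `(1 - s)T`. The
powers of `T` cancel, and the single factor `T` left over comes from `db / b = T ds`. -/
theorem integrable_and_integral_abelKernel {γ : ℝ} (h1 : -1 < γ) (h2 : γ < 1) {c x : ℝ}
    (hx : 0 < x) :
    Integrable (fun b => abelKernel γ c b x) volPos ∧
      ∫ b, abelKernel γ c b x ∂volPos = betaConst γ * logPow 1 c x := by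
  rcases le_or_gt c x with hc | hc
  · rw [abelKernel_eq_indicator hx, Ioo_eq_empty (not_lt.2 hc), logPow_of_le hc]
    simp
  have hxc : x ∈ Ioo 0 c := ⟨hx, hc⟩
  have hc0 : 0 < c := hx.trans hc
  set T := Real.log (c / x) with hT
  have hT0 : 0 < T := log_div_pos hxc
  have hd : ∀ s ∈ Ioo (0 : ℝ) 1, HasDerivWithinAt (fun s : ℝ => x * Real.exp (s * T))
      (T * (x * Real.exp (s * T))) (Ioo 0 1) s := fun s _ => by
    have := ((((hasDerivAt_id s).mul_const T).exp).const_mul x).hasDerivWithinAt (s := Ioo 0 1)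
    refine this.congr_deriv ?_
    simp only [id]
    ring
  have hinj : InjOn (fun s : ℝ => x * Real.exp (s * T)) (Ioo 0 1) := fun u _ v _ h =>
    mul_right_cancel₀ hT0.ne' (Real.exp_injective (mul_left_cancel₀ hx.ne' h))
  have heq : EqOn (fun s => |T * (x * Real.exp (s * T))| • ((x * Real.exp (s * T))⁻¹ *
        Real.log (c / (x * Real.exp (s * T))) ^ (-γ) * Real.log (x * Real.exp (s * T) / x) ^ γ))
      (fun s => T * (s ^ γ * (1 - s) ^ (-γ))) (Ioo 0 1) := fun s hs => by
    have e1 : x * Real.exp (s * T) / x = Real.exp (s * T) := by field_simp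
    have e2 : Real.log (c / (x * Real.exp (s * T))) = T * (1 - s) := by
      rw [← div_div, Real.log_div (by positivity) (by positivity), Real.log_exp, ← hT]
      ring
    have e3 : 0 < x * Real.exp (s * T) := by positivity
    simp only [e1, e2, Real.log_exp, smul_eq_mul]
    rw [abs_of_pos (by positivity), Real.mul_rpow hT0.le (sub_pos.2 hs.2).le,
      Real.mul_rpow hs.1.le hT0.le, Real.rpow_neg hT0.le]
    have : T ^ γ ≠ 0 := (Real.rpow_pos_of_pos hT0 _).ne'
    field_simp
  have hsub : Ioo x c ∩ Ioi 0 = Ioo x c :=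
    inter_eq_self_of_subset_left fun b hb => hx.trans hb.1
  rw [abelKernel_eq_indicator hx]
  constructor
  · rw [integrable_indicator_iff measurableSet_Ioo, volPos, IntegrableOn,
      Measure.restrict_restrict measurableSet_Ioo, hsub, ← IntegrableOn, ← image_mul_exp_Ioo hxc,
      integrableOn_image_iff_integrableOn_abs_deriv_smul measurableSet_Ioo hd hinj,
      integrableOn_congr_fun heq measurableSet_Ioo]
    exact (integrableOn_rpow_mul_one_sub_rpow h1 h2).const_mul T
  · rw [integral_indicator measurableSet_Ioo, volPos,
      Measure.restrict_restrict measurableSet_Ioo, hsub, ← image_mul_exp_Ioo hxc,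
      integral_image_eq_integral_abs_deriv_smul measurableSet_Ioo hd hinj,
      setIntegral_congr_fun measurableSet_Ioo heq, integral_const_mul, ← betaConst,
      logPow_of_mem hxc, Real.rpow_one, mul_comm]

theorem measurable_abelKernel_uncurry (γ c : ℝ) :
    Measurable fun p : ℝ × ℝ => abelKernel γ c p.2 p.1 :=
  (measurable_snd.inv.mul ((measurable_logPow (-γ) c).comp measurable_snd)).mul
    ((measurable_logPow_uncurry γ).comp (measurable_snd.prodMk measurable_fst))

theorem abelKernel_nonneg {γ c b x : ℝ} (hb : 0 < b) : 0 ≤ abelKernel γ c b x :=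
  mul_nonneg (mul_nonneg (inv_nonneg.2 hb.le) (logPow_nonneg _ _ _)) (logPow_nonneg _ _ _)

theorem ae_volPos_pos : ∀ᵐ x ∂volPos, 0 < x := ae_restrict_mem measurableSet_Ioi

instance : SFinite volPos := by unfold volPos; infer_instance

/-- Fubini applied to the Abel kernel times `h`. Absolute convergence holds because the kernel is
nonnegative and integrates in `b` to a multiple of `(log (c / x))_+`, which is in `L₂` like `h`. -/
theorem integral_logPow_one_mul_eq_zero {γ : ℝ} (h1 : -(1 / 2) < γ) (h2 : γ < 1 / 2)
    (h : Lp ℝ 2 volPos) (hh : ∀ b, 0 < b → ∫ x, logPow γ b x * h x ∂volPos = 0) (c : ℝ) :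
    ∫ x, logPow 1 c x * h x ∂volPos = 0 := by
  have hK := fun (x : ℝ) (hx : 0 < x) =>
    integrable_and_integral_abelKernel (γ := γ) (c := c) (by linarith) (by linarith) hx
  have hprod : Integrable (fun p : ℝ × ℝ => abelKernel γ c p.2 p.1 * h p.1)
      (volPos.prod volPos) := by
    rw [integrable_prod_iff]
    · constructor
      · filter_upwards [ae_volPos_pos] with x hx
        exact (hK x hx).1.mul_const _
      · have hi : Integrable (fun x => betaConst γ * (logPow 1 c x * ‖h x‖)) volPos :=
          ((memLp_logPow (γ := 1) (by norm_num) c).integrable_mul (Lp.memLp h).norm).const_mul _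
        refine hi.congr ?_
        filter_upwards [ae_volPos_pos] with x hx
        simp only [norm_mul]
        rw [integral_mul_const, ← mul_assoc, ← (hK x hx).2]
        congr 1
        refine integral_congr_ae ?_
        filter_upwards [ae_volPos_pos] with b hb
        rw [Real.norm_of_nonneg (abelKernel_nonneg hb)]
    · exact (measurable_abelKernel_uncurry γ c).aestronglyMeasurable.mul
        ((Lp.stronglyMeasurable h).comp_measurable measurable_fst).aestronglyMeasurable
  have hswap := integral_integral_swap (f := fun x b => abelKernel γ c b x * h x) hprod
  have hR : ∫ b, ∫ x, abelKernel γ c b x * h x ∂volPos ∂volPos = 0 := by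
    rw [← integral_zero ℝ ℝ (μ := volPos)]
    refine integral_congr_ae ?_
    filter_upwards [ae_volPos_pos] with b hb
    simp only [abelKernel, mul_assoc]
    rw [integral_const_mul, integral_const_mul, hh b hb, mul_zero, mul_zero]
  have hL : ∫ x, ∫ b, abelKernel γ c b x * h x ∂volPos ∂volPos
      = betaConst γ * ∫ x, logPow 1 c x * h x ∂volPos := by
    rw [← integral_const_mul]
    refine integral_congr_ae ?_
    filter_upwards [ae_volPos_pos] with x hx
    rw [integral_mul_const, (hK x hx).2, mul_assoc]
  rw [hR, hL] at hswap
  exact (mul_eq_zero.1 hswap).resolve_left (betaConst_pos (by linarith) (by linarith)).ne'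

/-! ### Differentiation in the endpoint and vanishing of `h` -/

theorem ae_eq_zero_of_forall_integral_Ioc_eq_zero (h : Lp ℝ 2 volPos)
    (hh : ∀ c, 0 < c → ∫ x in Ioc 0 c, h x = 0) : h = 0 := by
  rw [Lp.eq_zero_iff_ae_eq_zero]
  have hL : LocallyIntegrable ((Ioi 0).indicator h) volume := by
    refine MemLp.locallyIntegrable (p := 2) ?_ (by norm_num)
    rw [memLp_indicator_iff_restrict measurableSet_Ioi]
    exact Lp.memLp h
  have hd := _root_.LocallyIntegrable.ae_hasDerivAt_integral hL
  have : ∀ᵐ x ∂volume, x ∈ Ioi (0 : ℝ) → h x = 0 := by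
    filter_upwards [hd] with x hx hx0
    have h1 := hx 0
    rw [indicator_of_mem hx0] at h1
    refine h1.unique ((hasDerivAt_const x (0 : ℝ)).congr_of_eventuallyEq ?_)
    filter_upwards [Ioi_mem_nhds hx0] with y hy
    rw [intervalIntegral.integral_of_le (le_of_lt hy)]
    refine Eq.trans ?_ (hh y hy)
    refine setIntegral_congr_fun measurableSet_Ioc fun z (hz : z ∈ Ioc 0 y) => ?_
    exact indicator_of_mem (show z ∈ Ioi (0 : ℝ) from hz.1) (h : ℝ → ℝ)
  exact (ae_restrict_iff' measurableSet_Ioi).2 this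

/-- The difference quotient of `t ↦ (log (t / x))_+` in the variable `log t`. -/
theorem logPow_one_sub_div {c x ε : ℝ} (hx : 0 < x) (hc : 0 < c) (hε : 0 < ε) :
    (logPow 1 (c * Real.exp ε) x - logPow 1 c x) / ε ∈ Icc (0 : ℝ) 1 ∧
    (x ≤ c → (logPow 1 (c * Real.exp ε) x - logPow 1 c x) / ε = 1) ∧
    (c * Real.exp ε ≤ x → (logPow 1 (c * Real.exp ε) x - logPow 1 c x) / ε = 0) := by
  have he : 1 < Real.exp ε := Real.one_lt_exp_iff.2 hε
  have hce : c < c * Real.exp ε := by nlinarith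
  have hval : ∀ t, 0 < t → x < t → logPow 1 t x = Real.log t - Real.log x := fun t ht hxt => by
    rw [logPow_of_mem ⟨hx, hxt⟩, Real.rpow_one, Real.log_div ht.ne' hx.ne']
  have hlog : Real.log (c * Real.exp ε) = Real.log c + ε := by
    rw [Real.log_mul hc.ne' (Real.exp_pos _).ne', Real.log_exp]
  have h1 : x ≤ c → (logPow 1 (c * Real.exp ε) x - logPow 1 c x) / ε = 1 := fun hxc => by
    rw [hval _ (hc.trans hce) (hxc.trans_lt hce), hlog, div_eq_one_iff_eq hε.ne']
    rcases hxc.eq_or_lt with rfl | hlt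
    · rw [logPow_of_le le_rfl]; ring
    · rw [hval c hc hlt]; ring
  have h2 : c * Real.exp ε ≤ x → (logPow 1 (c * Real.exp ε) x - logPow 1 c x) / ε = 0 :=
    fun h => by rw [logPow_of_le h, logPow_of_le (hce.le.trans h)]; simp
  refine ⟨?_, h1, h2⟩
  rcases le_or_gt x c with hxc | hxc
  · rw [h1 hxc]; simp
  rcases le_or_gt (c * Real.exp ε) x with hxe | hxe
  · rw [h2 hxe]; simp
  · rw [hval _ (hc.trans hce) hxe, hlog, logPow_of_le hxc.le]
    have h3 : Real.log x < Real.log c + ε := by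
      rw [← hlog]; exact Real.log_lt_log hx hxe
    have h4 : Real.log c < Real.log x := Real.log_lt_log hc hxc
    constructor
    · apply div_nonneg _ hε.le; linarith
    · rw [div_le_one hε]; linarith

theorem integral_Ioc_eq_zero_of_logPow_one (h : Lp ℝ 2 volPos)
    (hh : ∀ c, 0 < c → ∫ x, logPow 1 c x * h x ∂volPos = 0) (c : ℝ) (hc : 0 < c) :
    ∫ x in Ioc 0 c, h x = 0 := by
  -- As `ε n ≤ 1`, on `x > 0` all difference quotients are dominated by the indicator of `(0, c e]`;
  -- they converge to that of `(0, c]`.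
  set ε : ℕ → ℝ := fun n => 1 / ((n : ℝ) + 1) with hε
  have hε0 : ∀ n, 0 < ε n := fun n => by positivity
  have hε1 : ∀ n, ε n ≤ 1 := fun n => by
    rw [hε]; simp only
    rw [div_le_one (by positivity)]
    have : (0 : ℝ) ≤ n := Nat.cast_nonneg n
    linarith
  have hεlim : Tendsto ε atTop (𝓝 0) := tendsto_one_div_add_atTop_nhds_zero_nat
  have hmem : MemLp ((Ioc 0 (c * Real.exp 1)).indicator fun _ => (1 : ℝ)) 2 volPos :=
    memLp_indicator_const 2 measurableSet_Ioc 1 (Or.inr (by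
      rw [volPos, Measure.restrict_apply measurableSet_Ioc]
      exact (lt_of_le_of_lt (measure_mono inter_subset_left) measure_Ioc_lt_top).ne))
  have hlim : Tendsto (fun n => ∫ x, (logPow 1 (c * Real.exp (ε n)) x - logPow 1 c x) / ε n * h x
      ∂volPos) atTop (𝓝 (∫ x, (Ioc 0 c).indicator (fun _ => (1 : ℝ)) x * h x ∂volPos)) := by
    refine tendsto_integral_of_dominated_convergence
      (fun x => (Ioc 0 (c * Real.exp 1)).indicator (fun _ => (1 : ℝ)) x * ‖h x‖) (fun n => ?_)
      (hmem.integrable_mul (Lp.memLp h).norm) (fun n => ?_) ?_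
    · exact (((measurable_logPow 1 _).sub (measurable_logPow 1 c)).div_const
        (ε n)).aestronglyMeasurable.mul (Lp.aestronglyMeasurable h)
    · filter_upwards [ae_volPos_pos] with x hx
      have h1 := logPow_one_sub_div hx hc (hε0 n)
      rw [norm_mul, Real.norm_of_nonneg h1.1.1]
      refine mul_le_mul_of_nonneg_right ?_ (norm_nonneg _)
      by_cases hxm : x ∈ Ioc 0 (c * Real.exp 1)
      · rw [indicator_of_mem hxm]; exact h1.1.2
      · rw [indicator_of_notMem hxm]
        refine (h1.2.2 ?_).le
        have : c * Real.exp 1 < x := not_le.1 fun h' => hxm ⟨hx, h'⟩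
        refine le_trans ?_ this.le
        gcongr
        exact hε1 n
    · filter_upwards [ae_volPos_pos] with x hx
      refine Tendsto.mul_const _ ?_
      rcases le_or_gt x c with hxc | hxc
      · rw [indicator_of_mem (show x ∈ Ioc 0 c from ⟨hx, hxc⟩)]
        exact tendsto_const_nhds.congr fun n => ((logPow_one_sub_div hx hc (hε0 n)).2.1 hxc).symm
      · rw [indicator_of_notMem (show x ∉ Ioc 0 c from fun h' => (not_le.2 hxc) h'.2)]
        have h2 : Tendsto (fun n => c * Real.exp (ε n)) atTop (𝓝 (c * Real.exp 0)) :=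
          ((Real.continuous_exp.tendsto 0).comp hεlim).const_mul c
        rw [Real.exp_zero, mul_one] at h2
        refine tendsto_const_nhds.congr' ?_
        filter_upwards [h2.eventually_lt_const hxc] with n hn
        exact ((logPow_one_sub_div hx hc (hε0 n)).2.2 hn.le).symm
  have hzero : ∀ n, ∫ x, (logPow 1 (c * Real.exp (ε n)) x - logPow 1 c x) / ε n * h x ∂volPos
      = 0 := fun n => by
    have hi : ∀ t, Integrable (fun x => logPow 1 t x * h x) volPos := fun t =>
      (memLp_logPow (by norm_num) t).integrable_mul (Lp.memLp h)
    have : ∀ x, (logPow 1 (c * Real.exp (ε n)) x - logPow 1 c x) / ε n * h x =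
        (ε n)⁻¹ * (logPow 1 (c * Real.exp (ε n)) x * h x - logPow 1 c x * h x) := fun x => by ring
    simp_rw [this]
    rw [integral_const_mul, integral_sub (hi _) (hi _), hh _ (by positivity), hh _ hc]
    simp
  simp_rw [hzero] at hlim
  have h3 := tendsto_nhds_unique tendsto_const_nhds hlim
  have h4 : ∀ x, (Ioc 0 c).indicator (fun _ => (1 : ℝ)) x * h x = (Ioc 0 c).indicator h x :=
    fun x => by by_cases hx : x ∈ Ioc 0 c <;> simp [hx]
  have h5 : volPos.restrict (Ioc 0 c) = volume.restrict (Ioc 0 c) := by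
    rw [volPos, Measure.restrict_restrict measurableSet_Ioc,
      inter_eq_self_of_subset_left Ioc_subset_Ioi_self]
  simp_rw [h4] at h3
  rw [integral_indicator measurableSet_Ioc, h5] at h3
  exact h3.symm

theorem eq_zero_of_forall_integral_logPow_eq_zero {γ : ℝ} (h1 : -(1 / 2) < γ) (h2 : γ < 1 / 2)
    (h : Lp ℝ 2 volPos) (hh : ∀ b, 0 < b → ∫ x, logPow γ b x * h x ∂volPos = 0) : h = 0 :=
  ae_eq_zero_of_forall_integral_Ioc_eq_zero h <| integral_Ioc_eq_zero_of_logPow_one h fun c _ =>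
    integral_logPow_one_mul_eq_zero h1 h2 h hh c

/-! ### Density of the log powers in `L₂(ℝ⁺)` -/

theorem logPow_zero_left (t : ℝ) : logPow 0 t = (Ioo 0 t).indicator fun _ => 1 := by
  simp [logPow]

/-- The class in `L₂(ℝ⁺)` of `s ↦ c (log (t / s))^γ` on `(0, t)`. -/
def logPowLp {γ : ℝ} (hγ : -(1 / 2) < γ) (c t : ℝ) : Lp ℝ 2 volPos :=
  c • (memLp_logPow hγ t).toLp

theorem coeFn_logPowLp {γ : ℝ} (hγ : -(1 / 2) < γ) (c t : ℝ) :
    logPowLp hγ c t =ᵐ[volPos] fun s => c * logPow γ t s := by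
  filter_upwards [Lp.coeFn_smul c (memLp_logPow hγ t).toLp, (memLp_logPow hγ t).coeFn_toLp]
    with x h1 h2
  rw [logPowLp, h1, Pi.smul_apply, h2, smul_eq_mul]

theorem logPowLp_zero_right {γ : ℝ} (hγ : -(1 / 2) < γ) (c : ℝ) : logPowLp hγ c 0 = 0 := by
  rw [Lp.eq_zero_iff_ae_eq_zero]
  filter_upwards [coeFn_logPowLp hγ c 0] with x hx
  simp [hx, logPow_zero_right]

theorem inner_logPowLp {γ : ℝ} (hγ : -(1 / 2) < γ) (c t : ℝ) (h : Lp ℝ 2 volPos) :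
    inner ℝ (logPowLp hγ c t) h = c * ∫ x, logPow γ t x * h x ∂volPos := by
  rw [L2.inner_def, ← integral_const_mul]
  refine integral_congr_ae ?_
  filter_upwards [coeFn_logPowLp hγ c t] with x hx
  rw [hx]
  simp only [RCLike.inner_apply, conj_trivial]
  ring

theorem tendsto_logPowLp_nhds_zero {γ : ℝ} (hγ : -(1 / 2) < γ) (c : ℝ) :
    Tendsto (logPowLp hγ c) (𝓝[>] 0) (𝓝 0) := by
  have h0 : Tendsto (fun t : ℝ => |c| * √(t * Real.Gamma (2 * γ + 1))) (𝓝[>] 0) (𝓝 0) := by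
    have : Continuous fun t : ℝ => |c| * √(t * Real.Gamma (2 * γ + 1)) := by fun_prop
    have h1 := (this.tendsto 0).mono_left (nhdsWithin_le_nhds (s := Ioi 0))
    simpa using h1
  refine tendsto_zero_iff_norm_tendsto_zero.2 (h0.congr' ?_)
  filter_upwards [self_mem_nhdsWithin] with t ht
  rw [logPowLp, norm_smul, Real.norm_eq_abs, ← norm_toLp_logPow hγ (le_of_lt ht),
    Real.sqrt_sq (norm_nonneg _)]

/-- The increments of `t ↦ c (log (t / ·))_+ ^ γ` over intervals bounded away from zero are total
in `L₂(ℝ⁺)`. -/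
theorem dense_span_logPowLp_sub {γ c : ℝ} (h1 : -(1 / 2) < γ) (h2 : γ < 1 / 2) (hc : c ≠ 0) :
    Dense (Submodule.span ℝ {g : Lp ℝ 2 volPos | ∃ a b : ℝ, 0 < a ∧ a < b ∧
      g = logPowLp h1 c b - logPowLp h1 c a} : Set (Lp ℝ 2 volPos)) := by
  rw [Submodule.dense_iff_topologicalClosure_eq_top, Submodule.topologicalClosure_eq_top_iff,
    Submodule.eq_bot_iff]
  intro h hh
  rw [Submodule.mem_orthogonal] at hh
  -- Orthogonality to increments only makes this inner product constant in `b`; its limit at `0`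
  -- shows that the constant is zero.
  have hb : ∀ b, 0 < b → inner ℝ (logPowLp h1 c b) h = 0 := fun b hb => by
    have hlim : Tendsto (fun a => inner ℝ (logPowLp h1 c a) h) (𝓝[>] 0) (𝓝 (inner ℝ 0 h)) :=
      (tendsto_logPowLp_nhds_zero h1 c).inner tendsto_const_nhds
    rw [inner_zero_left] at hlim
    refine tendsto_nhds_unique (tendsto_const_nhds.congr' ?_) hlim
    filter_upwards [Ioo_mem_nhdsGT hb] with a ha
    have := hh _ (Submodule.subset_span ⟨a, b, ha.1, ha.2, rfl⟩)
    rw [inner_sub_left] at this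
    linarith
  refine eq_zero_of_forall_integral_logPow_eq_zero h1 h2 h fun b hb0 => ?_
  have := hb b hb0
  rw [inner_logPowLp] at this
  exact (mul_eq_zero.1 this).resolve_left hc

theorem dense_span_range_logPowLp {γ c : ℝ} (h1 : -(1 / 2) < γ) (h2 : γ < 1 / 2) (hc : c ≠ 0) :
    Dense (Submodule.span ℝ (range fun t : ℝ≥0 => logPowLp h1 c t) : Set (Lp ℝ 2 volPos)) := by
  refine (dense_span_logPowLp_sub h1 h2 hc).mono (Submodule.span_le.2 ?_)
  rintro g ⟨a, b, ha, hab, rfl⟩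
  exact Submodule.sub_mem _ (Submodule.subset_span ⟨⟨b, (ha.trans hab).le⟩, rfl⟩)
    (Submodule.subset_span ⟨⟨a, ha.le⟩, rfl⟩)

/-! ### Almost-everywhere invariance and linearity of `M^α_-` -/

theorem hadamardIntegrand_congr_ae {β : ℝ} {f g : ℝ → ℝ} (h : f =ᵐ[volPos] g) {x : ℝ}
    (hx : 0 < x) :
    hadamardIntegrand β f x =ᵐ[volume.restrict (Ioi x)] hadamardIntegrand β g x := by
  have : ∀ᵐ z ∂volume.restrict (Ioi x), f z = g z :=
    ae_restrict_of_ae_restrict_of_subset (Ioi_subset_Ioi hx.le) h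
  filter_upwards [this] with z hz
  rw [hadamardIntegrand, hadamardIntegrand, hz]

/-- Equality at every `x > 0`, not just almost every one, is what allows differentiating both sides
when `α < 1`. -/
theorem hadamardIntegral_congr_ae {β : ℝ} {f g : ℝ → ℝ} (h : f =ᵐ[volPos] g) {x : ℝ}
    (hx : 0 < x) : hadamardIntegral β f x = hadamardIntegral β g x := by
  rw [hadamardIntegral, hadamardIntegral, integral_congr_ae (hadamardIntegrand_congr_ae h hx)]

theorem hadamardIntegrand_linearCombination (β : ℝ) (f g : ℝ → ℝ) (a b x : ℝ) :
    hadamardIntegrand β (fun z => a * f z + b * g z) x =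
      fun z => a * hadamardIntegrand β f x z + b * hadamardIntegrand β g x z := by
  ext z
  simp only [hadamardIntegrand]
  ring

theorem hadamardIntegral_linearCombination {β : ℝ} {f g : ℝ → ℝ} {x : ℝ} (a b : ℝ)
    (hf : IntegrableOn (hadamardIntegrand β f x) (Ioi x))
    (hg : IntegrableOn (hadamardIntegrand β g x) (Ioi x)) :
    IntegrableOn (hadamardIntegrand β (fun z => a * f z + b * g z) x) (Ioi x) ∧
    hadamardIntegral β (fun z => a * f z + b * g z) x =
      a * hadamardIntegral β f x + b * hadamardIntegral β g x := by
  simp only [hadamardIntegral, hadamardIntegrand_linearCombination]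
  refine ⟨(hf.const_mul a).add (hg.const_mul b), ?_⟩
  rw [integral_add (hf.const_mul a) (hg.const_mul b), integral_const_mul, integral_const_mul]
  ring

theorem HadamardDefined.congr_ae {α : ℝ} {f g : ℝ → ℝ} (hf : HadamardDefined α f)
    (h : f =ᵐ[volPos] g) : HadamardDefined α g := by
  unfold HadamardDefined at hf ⊢
  split_ifs at hf ⊢ with h1 h2
  · refine ⟨fun x hx => (hf.1 x hx).congr (hadamardIntegrand_congr_ae h hx), ?_⟩
    filter_upwards [hf.2, ae_volPos_pos] with x hd hx
    refine hd.congr_of_eventuallyEq ?_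
    filter_upwards [Ioi_mem_nhds hx] with y hy
    exact (hadamardIntegral_congr_ae h hy).symm
  · filter_upwards [hf, ae_volPos_pos] with x hi hx
    exact hi.congr (hadamardIntegrand_congr_ae h hx)

theorem hadamardM_congr_ae {α : ℝ} {f g : ℝ → ℝ} (h : f =ᵐ[volPos] g) :
    hadamardM α f =ᵐ[volPos] hadamardM α g := by
  filter_upwards [h, ae_volPos_pos] with x hfg hx
  unfold hadamardM
  split_ifs
  · rw [hadamardDeriv, hadamardDeriv]
    congr 2
    refine Filter.EventuallyEq.deriv_eq ?_
    filter_upwards [Ioi_mem_nhds hx] with y hy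
    exact hadamardIntegral_congr_ae h hy
  · exact hfg
  · rw [hadamardIntegral_congr_ae h hx]

theorem HadamardDefined.linearCombination {α : ℝ} {f g : ℝ → ℝ} (a b : ℝ)
    (hf : HadamardDefined α f) (hg : HadamardDefined α g) :
    HadamardDefined α (fun z => a * f z + b * g z) ∧
    hadamardM α (fun z => a * f z + b * g z) =ᵐ[volPos]
      fun x => a * hadamardM α f x + b * hadamardM α g x := by
  unfold HadamardDefined at hf hg ⊢
  unfold hadamardM
  split_ifs at hf hg ⊢ with h1 h2
  · have key := fun (x : ℝ) (hx : 0 < x) =>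
      hadamardIntegral_linearCombination a b (hf.1 x hx) (hg.1 x hx)
    have hd : ∀ᵐ x ∂volPos,
        HasDerivAt (hadamardIntegral (1 - (1 - α) / 2) fun z => a * f z + b * g z)
          (a * deriv (hadamardIntegral (1 - (1 - α) / 2) f) x +
            b * deriv (hadamardIntegral (1 - (1 - α) / 2) g) x) x := by
      filter_upwards [hf.2, hg.2, ae_volPos_pos] with x hdf hdg hx
      refine ((hdf.hasDerivAt.const_mul a).add (hdg.hasDerivAt.const_mul b)).congr_of_eventuallyEq
        ?_
      filter_upwards [Ioi_mem_nhds hx] with y hy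
      exact (key y hy).2
    refine ⟨⟨fun x hx => (key x hx).1, hd.mono fun x hx => hx.differentiableAt⟩, ?_⟩
    filter_upwards [hd] with x hx
    rw [hadamardDeriv, hx.deriv, hadamardDeriv, hadamardDeriv]
    ring
  · exact ⟨trivial, Filter.EventuallyEq.rfl⟩
  · constructor
    · filter_upwards [hf, hg] with x hxf hxg
      exact (hadamardIntegral_linearCombination a b hxf hxg).1
    · filter_upwards [hf, hg] with x hxf hxg
      rw [(hadamardIntegral_linearCombination a b hxf hxg).2]
      ring

/-! ### Action of `M^α_-` on indicators -/

/-- The indicator function of `(-∞, t)`. -/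
def indIio (t : ℝ) : ℝ → ℝ := (Iio t).indicator fun _ => 1

theorem hadamardIntegrand_indIio (β t x : ℝ) :
    hadamardIntegrand β (indIio t) x =
      (Iio t).indicator fun z => Real.log (z / x) ^ (β - 1) * z⁻¹ := by
  ext z
  by_cases hz : z ∈ Iio t <;> simp [hadamardIntegrand, indIio, hz]

theorem hadamardIntegral_indIio {β x : ℝ} (hβ : 0 < β) (hx : 0 < x) (t : ℝ) :
    IntegrableOn (hadamardIntegrand β (indIio t) x) (Ioi x) ∧
      hadamardIntegral β (indIio t) x = 1 / Real.Gamma (β + 1) * logPow β t x := by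
  rw [hadamardIntegral, hadamardIntegrand_indIio, IntegrableOn,
    integrable_indicator_iff measurableSet_Iio, integral_indicator measurableSet_Iio,
    IntegrableOn, Measure.restrict_restrict measurableSet_Iio, inter_comm, Ioi_inter_Iio]
  rcases le_or_gt t x with ht | ht
  · rw [logPow_of_le ht, Ioo_eq_empty (not_lt.2 ht)]
    simp
  set F : ℝ → ℝ := fun z => Real.log (z / x) ^ β / β with hF
  have hcont : ContinuousOn F (Icc x t) := by
    refine ContinuousOn.div_const (ContinuousOn.rpow_const (ContinuousOn.log (by fun_prop)
      fun z hz => (div_pos (hx.trans_le hz.1) hx).ne') fun z _ => Or.inr hβ.le) β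
  have hd : ∀ z ∈ Ioo x t, HasDerivAt F (Real.log (z / x) ^ (β - 1) * z⁻¹) z := fun z hz => by
    have hz0 : 0 < z := hx.trans hz.1
    have h1 := ((((hasDerivAt_id z).div_const x).log (div_pos hz0 hx).ne').rpow_const (p := β)
      (Or.inl (log_div_pos (t := z) ⟨hx, hz.1⟩).ne')).div_const β
    refine h1.congr_deriv ?_
    simp only [id]
    field_simp
  have hnn : ∀ z ∈ Ioo x t, 0 ≤ Real.log (z / x) ^ (β - 1) * z⁻¹ := fun z hz =>
    mul_nonneg (Real.rpow_nonneg (log_div_pos (t := z) ⟨hx, hz.1⟩).le _)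
      (inv_nonneg.2 (hx.trans hz.1).le)
  -- For `β < 1` the integrand is singular at `z = x`; it is integrable as the nonnegative
  -- derivative of a function continuous up to `x`.
  have hint : IntegrableOn (fun z => Real.log (z / x) ^ (β - 1) * z⁻¹) (Ioc x t) :=
    intervalIntegral.integrableOn_deriv_of_nonneg hcont hd hnn
  refine ⟨hint.mono_set Ioo_subset_Ioc_self, ?_⟩
  rw [← integral_Ioc_eq_integral_Ioo, ← intervalIntegral.integral_of_le ht.le,
    intervalIntegral.integral_eq_sub_of_hasDerivAt_of_le ht.le hcont hd
      ((intervalIntegrable_iff_integrableOn_Ioc_of_le ht.le).2 hint),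
    logPow_of_mem ⟨hx, ht⟩, Real.Gamma_add_one hβ.ne']
  simp only [hF, div_self hx.ne', Real.log_one, Real.zero_rpow hβ.ne']
  have := (Real.Gamma_pos_of_pos hβ).ne'
  field_simp
  ring

theorem hasDerivAt_logPow {β x t : ℝ} (hx : 0 < x) (hxt : x ≠ t) :
    HasDerivAt (logPow β t) (-(β * logPow (β - 1) t x) / x) x := by
  rcases lt_or_gt_of_ne hxt with h | h
  · have ht : 0 < t := hx.trans h
    have h1 := (((hasDerivAt_inv hx.ne').const_mul t).log
      (mul_pos ht (inv_pos.2 hx)).ne').rpow_const (p := β)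
      (Or.inl (log_div_pos (t := t) ⟨hx, h⟩).ne')
    refine (h1.congr_deriv ?_).congr_of_eventuallyEq ?_
    · rw [logPow_of_mem ⟨hx, h⟩, div_eq_mul_inv t x]
      field_simp
    · filter_upwards [Ioo_mem_nhds hx h] with y hy
      rw [logPow_of_mem hy, div_eq_mul_inv]
  · rw [logPow_of_le h.le, mul_zero, neg_zero, zero_div]
    refine (hasDerivAt_const x (0 : ℝ)).congr_of_eventuallyEq ?_
    filter_upwards [Ioi_mem_nhds h] with y hy
    exact logPow_of_le (le_of_lt hy)

/-- For `α < 1`, differentiating the integral of order `β = (α + 1) / 2` lowers the exponent to `(α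
- 1) / 2` and leaves `β / Γ(β + 1) = 1 / Γ(β)`. For `α > 1`, the integral already has that exponent
and the factor `1 / Γ((α + 1) / 2)`. `K_α` cancels either one. -/
theorem hadamardM_indIio {α : ℝ} (hα : α ∈ Ioo (0 : ℝ) 1 ∪ Ioo (1 : ℝ) 2) (t : ℝ) :
    HadamardDefined α (indIio t) ∧ hadamardM α (indIio t) =ᵐ[volPos]
      fun x => 1 / √(Real.Gamma α) * logPow ((α - 1) / 2) t x := by
  unfold HadamardDefined hadamardM
  rcases hα with hα | hα
  · simp only [if_pos hα.2]
    set β := 1 - (1 - α) / 2 with hβ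
    have hβ0 : 0 < β := by linarith [hα.1]
    have hne : ∀ᵐ x ∂volPos, x ≠ t :=
      ae_restrict_of_ae (by simp [ae_iff, measure_singleton])
    have hd : ∀ᵐ x ∂volPos, HasDerivAt (hadamardIntegral β (indIio t))
        (1 / Real.Gamma (β + 1) * (-(β * logPow (β - 1) t x) / x)) x := by
      filter_upwards [hne, ae_volPos_pos] with x hxt hx
      refine ((hasDerivAt_logPow hx hxt).const_mul _).congr_of_eventuallyEq ?_
      filter_upwards [Ioi_mem_nhds hx] with y hy
      exact (hadamardIntegral_indIio hβ0 hy t).2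
    refine ⟨⟨fun x hx => (hadamardIntegral_indIio hβ0 hx t).1,
      hd.mono fun x hx => hx.differentiableAt⟩, ?_⟩
    filter_upwards [hd, ae_volPos_pos] with x hx hx0
    have e1 : β - 1 = (α - 1) / 2 := by rw [hβ]; ring
    have e2 : (α + 1) / 2 = β := by rw [hβ]; ring
    rw [hadamardDeriv, hx.deriv, hadamardConst, e1, e2, Real.Gamma_add_one hβ0.ne']
    have := (Real.Gamma_pos_of_pos hβ0).ne'
    field_simp
  · simp only [if_neg (not_lt.2 hα.1.le), if_neg hα.1.ne']
    have hβ0 : 0 < (α - 1) / 2 := by linarith [hα.1]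
    constructor
    · filter_upwards [ae_volPos_pos] with x hx
      exact (hadamardIntegral_indIio hβ0 hx t).1
    · filter_upwards [ae_volPos_pos] with x hx
      have e2 : (α + 1) / 2 = (α - 1) / 2 + 1 := by ring
      rw [(hadamardIntegral_indIio hβ0 hx t).2, hadamardConst, e2]
      have := (Real.Gamma_pos_of_pos (show 0 < (α - 1) / 2 + 1 by linarith)).ne'
      generalize Real.Gamma ((α - 1) / 2 + 1) = G at this ⊢
      field_simp

theorem indIio_sub_indIio {a b : ℝ} (hab : a ≤ b) (x : ℝ) :
    indIio b x - indIio a x = (Ico a b).indicator (fun _ => 1) x := by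
  simp only [indIio, indicator, mem_Iio, mem_Ico]
  split_ifs <;> grind

theorem StepFunction.toFun_eq_integral_indIio (φ : StepFunction) :
    φ.toFun = φ.integral fun t => indIio t := by
  ext x
  refine Finset.sum_congr rfl fun k _ => ?_
  rw [indIio_sub_indIio]
  exact_mod_cast φ.strictMono.monotone (Fin.castSucc_lt_succ (i := k)).le

theorem indIoo_ae_eq (a b : ℝ) (hab : a < b) :
    indIoo a b =ᵐ[volPos] fun x => 1 * indIio b x + (-1) * indIio a x := by
  have : ∀ᵐ x ∂volPos, x ≠ a := ae_restrict_of_ae (by simp [ae_iff, measure_singleton])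
  filter_upwards [this] with x hx
  simp only [indIio, indIoo, indicator, mem_Iio, mem_Ioo]
  split_ifs <;> grind

/-! ### The Wiener map of a Brownian motion -/

/-- The class of `1_{(0, t)}` in `L₂(ℝ⁺)`. -/
def indLp (t : ℝ≥0) : Lp ℝ 2 volPos :=
  logPowLp (γ := 0) (by norm_num) 1 t

theorem coeFn_indLp (t : ℝ≥0) : indLp t =ᵐ[volPos] indIio t := by
  filter_upwards [coeFn_logPowLp (γ := 0) (by norm_num) 1 t, ae_volPos_pos] with x hx hx0
  rw [indLp, hx, logPow_zero_left]
  simp [indIio, indicator, hx0]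

theorem inner_indLp (s t : ℝ≥0) : inner ℝ (indLp s) (indLp t) = min (s : ℝ) t := by
  have h : ∫ x, logPow 0 s x * indLp t x ∂volPos = ∫ x, logPow 0 (min (s : ℝ) t) x ∂volPos := by
    refine integral_congr_ae ?_
    filter_upwards [coeFn_indLp t, ae_volPos_pos] with x hx hx0
    rw [hx, logPow_zero_left, logPow_zero_left]
    simp only [indIio, indicator, mem_Ioo, mem_Iio, lt_min_iff]
    split_ifs <;> grind
  rw [indLp, inner_logPowLp, h, integral_logPow (by norm_num) (by positivity)]
  simp

theorem dense_span_range_indLp :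
    Dense (Submodule.span ℝ (range indLp) : Set (Lp ℝ 2 volPos)) :=
  dense_span_range_logPowLp (by norm_num) (by norm_num) one_ne_zero

section Wiener

variable {Ω : Type*} [MeasurableSpace Ω] {P : Measure Ω} {B : ℝ≥0 → Ω → ℝ}

/-- `U` carries step functions to their elementary integrals, so by continuity every approximating
sequence has the limit `U G`; one exists by density of step functions. -/
theorem isWienerIntegral_iff {b : ℝ≥0 → Lp ℝ 2 P} (hb : ∀ t, b t =ᵐ[P] B t)
    {U : Lp ℝ 2 volPos →L[ℝ] Lp ℝ 2 P} (hU : ∀ t, U (indLp t) = b t)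
    {G : Lp ℝ 2 volPos} {Y : Lp ℝ 2 P} {g : ℝ → ℝ} {Z : Ω → ℝ}
    (hG : G =ᵐ[volPos] g) (hY : Y =ᵐ[P] Z) : IsWienerIntegral P B g Z ↔ U G = Y := by
  have key1 : ∀ φ : ℕ → StepFunction,
      Tendsto (fun n => eLpNorm (fun x => (φ n).toFun x - g x) 2 volPos) atTop (𝓝 0) ↔
        Tendsto (fun n => (φ n).sum indLp) atTop (𝓝 G) := fun φ =>
    tendsto_eLpNorm_sub_iff fun n => coeFn_sub_ae_eq (by
      rw [StepFunction.toFun_eq_integral_indIio]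
      exact coeFn_stepFunction_sum coeFn_indLp _) hG
  have key2 : ∀ φ : ℕ → StepFunction,
      Tendsto (fun n => eLpNorm (fun ω => (φ n).integral B ω - Z ω) 2 P) atTop (𝓝 0) ↔
        Tendsto (fun n => U ((φ n).sum indLp)) atTop (𝓝 Y) := fun φ =>
    tendsto_eLpNorm_sub_iff fun n => coeFn_sub_ae_eq (by
      have := (φ n).map_sum U.toLinearMap indLp
      simp only [ContinuousLinearMap.coe_coe, hU] at this
      rw [this]
      exact coeFn_stepFunction_sum hb _) hY
  constructor
  · rintro ⟨-, -, φ, h1, h2⟩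
    rw [key1] at h1
    rw [key2] at h2
    exact tendsto_nhds_unique ((U.continuous.tendsto G).comp h1) h2
  · rintro rfl
    obtain ⟨φ, hφ⟩ := exists_stepFunction_tendsto (logPowLp_zero_right _ _)
      dense_span_range_indLp G
    exact ⟨(memLp_congr_ae hG).1 (Lp.memLp G), (memLp_congr_ae hY).1 (Lp.memLp _), φ,
      (key1 φ).2 hφ, (key2 φ).2 ((U.continuous.tendsto G).comp hφ)⟩

theorem exists_wienerIsometry [IsProbabilityMeasure P] (hB : IsPreBrownianReal B P) :
    ∃ b : ℝ≥0 → Lp ℝ 2 P, (∀ t, b t =ᵐ[P] B t) ∧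
      ∃ U : Lp ℝ 2 volPos →L[ℝ] Lp ℝ 2 P, ∀ t, U (indLp t) = b t := by
  have hm : ∀ t, MemLp (B t) 2 P := fun t =>
    (hB.isGaussianProcess.hasGaussianLaw_eval t).memLp_two
  refine ⟨fun t => (hm t).toLp, fun t => (hm t).coeFn_toLp,
    exists_continuousLinearMap_of_inner_eq (fun s t => ?_) dense_span_range_indLp⟩
  have hcov := hB.covariance_eval s t
  rw [covariance_eq_sub (hm s) (hm t), hB.integral_eval, zero_mul, sub_zero] at hcov
  have : inner ℝ ((hm s).toLp) ((hm t).toLp) = ∫ ω, (B s * B t) ω ∂P := by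
    rw [L2.inner_def]
    refine integral_congr_ae ?_
    filter_upwards [(hm s).coeFn_toLp, (hm t).coeFn_toLp] with ω h1 h2
    simp [h1, h2, mul_comm]
  rw [inner_indLp, this, hcov, NNReal.coe_min]

end Wiener

/-! ### Step functions under `M^α_-` and the fractional process -/

theorem hadamardM_sum {α : ℝ} {ι : Type*} (s : Finset ι) (a : ι → ℝ) {f g : ι → ℝ → ℝ}
    (hf : ∀ i, HadamardDefined α (f i)) (hg : ∀ i, hadamardM α (f i) =ᵐ[volPos] g i)
    (h0 : HadamardDefined α 0) :
    HadamardDefined α (fun x => ∑ i ∈ s, a i * f i x) ∧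
      hadamardM α (fun x => ∑ i ∈ s, a i * f i x) =ᵐ[volPos] fun x => ∑ i ∈ s, a i * g i x := by
  classical
  induction s using Finset.induction_on with
  | empty =>
    -- Linearity with zero coefficients yields `M^α_- 0 = 0`.
    have h := (h0.linearCombination 0 0 h0).2
    simp only [zero_mul, add_zero] at h
    simp only [Finset.sum_empty]
    exact ⟨h0, h⟩
  | insert i s hi ih =>
    have h := (hf i).linearCombination (a i) 1 ih.1
    simp only [one_mul] at h
    simp only [Finset.sum_insert hi]
    refine ⟨h.1, ?_⟩
    filter_upwards [h.2, hg i, ih.2] with x h1 h2 h3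
    rw [h1, h2, h3]


theorem hadamardM_sub_indIio {α : ℝ} (hα : α ∈ Ioo (0 : ℝ) 1 ∪ Ioo (1 : ℝ) 2) (a b : ℝ) :
    HadamardDefined α (fun x => indIio b x - indIio a x) ∧
      hadamardM α (fun x => indIio b x - indIio a x) =ᵐ[volPos] fun x =>
        1 / √(Real.Gamma α) * logPow ((α - 1) / 2) b x -
          1 / √(Real.Gamma α) * logPow ((α - 1) / 2) a x := by
  have ha := hadamardM_indIio hα a
  have hb := hadamardM_indIio hα b
  have h := hb.1.linearCombination 1 (-1) ha.1
  simp only [one_mul, neg_one_mul, ← sub_eq_add_neg] at h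
  refine ⟨h.1, ?_⟩
  filter_upwards [h.2, ha.2, hb.2] with x h1 h2 h3
  rw [h1, h2, h3]

theorem hadamardM_indIoo {α : ℝ} (hα : α ∈ Ioo (0 : ℝ) 1 ∪ Ioo (1 : ℝ) 2)
    (hγ : -(1 / 2) < (α - 1) / 2) {a b : ℝ} (hab : a < b) :
    HadamardDefined α (indIoo a b) ∧
      ⇑(logPowLp hγ (1 / √(Real.Gamma α)) b - logPowLp hγ (1 / √(Real.Gamma α)) a) =ᵐ[volPos]
        hadamardM α (indIoo a b) := by
  have h := hadamardM_sub_indIio hα a b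
  have he : (fun x => indIio b x - indIio a x) =ᵐ[volPos] indIoo a b := by
    simpa [← sub_eq_add_neg] using (indIoo_ae_eq a b hab).symm
  refine ⟨h.1.congr_ae he, ?_⟩
  exact (coeFn_sub_ae_eq (coeFn_logPowLp _ _ _) (coeFn_logPowLp _ _ _)).trans
    (h.2.symm.trans (hadamardM_congr_ae he))

theorem hadamardM_stepFunction {α : ℝ} (hα : α ∈ Ioo (0 : ℝ) 1 ∪ Ioo (1 : ℝ) 2)
    (hγ : -(1 / 2) < (α - 1) / 2) (φ : StepFunction) :
    HadamardDefined α φ.toFun ∧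
      ⇑(φ.sum fun t => logPowLp hγ (1 / √(Real.Gamma α)) t) =ᵐ[volPos]
        hadamardM α φ.toFun := by
  have h0 : HadamardDefined α 0 := by
    have h := ((hadamardM_indIio hα 0).1.linearCombination 0 0 (hadamardM_indIio hα 0).1).1
    simp only [zero_mul, add_zero] at h
    exact h
  have h := hadamardM_sum Finset.univ φ.a
    (fun k => (hadamardM_sub_indIio hα (φ.t k.castSucc) (φ.t k.succ)).1)
    (fun k => (hadamardM_sub_indIio hα (φ.t k.castSucc) (φ.t k.succ)).2) h0
  rw [StepFunction.toFun_eq_integral_indIio]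
  exact ⟨h.1, (coeFn_stepFunction_sum (fun t => coeFn_logPowLp hγ _ t) φ).trans h.2.symm⟩

theorem isHadamardFBM_ae_eq {α : ℝ} {Ω : Type*} [MeasurableSpace Ω] {P : Measure Ω}
    {B X : ℝ≥0 → Ω → ℝ} (hγ : -(1 / 2) < (α - 1) / 2) {b : ℝ≥0 → Lp ℝ 2 P}
    (hb : ∀ t, b t =ᵐ[P] B t) {U : Lp ℝ 2 volPos →L[ℝ] Lp ℝ 2 P}
    (hU : ∀ t, U (indLp t) = b t) (hX : IsHadamardFBM P α B X) (t : ℝ≥0) :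
    U (logPowLp hγ (1 / √(Real.Gamma α)) t) =ᵐ[P] X t := by
  have hG : logPowLp hγ (1 / √(Real.Gamma α)) t =ᵐ[volPos] (Ioo (0 : ℝ) t).indicator
      fun s => 1 / √(Real.Gamma α) * Real.log (t / s) ^ ((α - 1) / 2) := by
    filter_upwards [coeFn_logPowLp hγ (1 / √(Real.Gamma α)) t] with x hx
    rw [hx, logPow, indicator_const_mul]
  rw [(isWienerIntegral_iff hb hU hG (hX t).memLp.coeFn_toLp).1 (hX t)]
  exact (hX t).memLp.coeFn_toLp

end

/-! ### The theorem -/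

theorem theorem7p3 (α : ℝ) (hα : α ∈ Ioo (0 : ℝ) 1 ∪ Ioo (1 : ℝ) 2) :
    -- every generator is a genuine element of `L₂(ℝ⁺)`
    (∀ a b : ℝ, 0 ≤ a → a < b → MemHadamardL2 α (indIoo a b)) ∧
    -- density of the span of the generators with `0 ≤ a < b`
    Dense ((Submodule.span ℝ {g : Lp ℝ 2 volPos | ∃ a b : ℝ, 0 ≤ a ∧ a < b ∧
      (g : ℝ → ℝ) =ᵐ[volPos] hadamardM α (indIoo a b)} : Submodule ℝ (Lp ℝ 2 volPos)) :
        Set (Lp ℝ 2 volPos)) ∧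
    -- density already with the generators such that `0 < a < b`
    Dense ((Submodule.span ℝ {g : Lp ℝ 2 volPos | ∃ a b : ℝ, 0 < a ∧ a < b ∧
      (g : ℝ → ℝ) =ᵐ[volPos] hadamardM α (indIoo a b)} : Submodule ℝ (Lp ℝ 2 volPos)) :
        Set (Lp ℝ 2 volPos)) ∧
    -- the Wiener integral with respect to the process is well defined on `L_{2,α}(ℝ⁺)`
    (∀ f : ℝ → ℝ, MemHadamardL2 α f →
      (∃ φ : ℕ → StepFunction,
        (∀ n, MemHadamardL2 α (φ n).toFun) ∧ TendstoHadamardL2 α φ f) ∧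
      ∀ (Ω : Type*) [MeasurableSpace Ω] (P : Measure Ω) [IsProbabilityMeasure P]
        (B X : ℝ≥0 → Ω → ℝ), IsPreBrownianReal B P → IsHadamardFBM P α B X →
        ∃! I : Lp ℝ 2 P,
          IsWienerIntegral P B (hadamardM α f) I ∧
          ∀ φ : ℕ → StepFunction, TendstoHadamardL2 α φ f →
            Tendsto (fun n => eLpNorm (fun ω => (φ n).integral X ω - I ω) 2 P)
              atTop (𝓝 0)) := by
  have hγ1 : -(1 / 2) < (α - 1) / 2 := by
    rcases hα with h | h <;> linarith [h.1]
  have hγ2 : (α - 1) / 2 < 1 / 2 := by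
    rcases hα with h | h <;> linarith [h.2]
  have hα0 : 0 < α := by
    rcases hα with h | h <;> linarith [h.1]
  have hc : 1 / √(Real.Gamma α) ≠ 0 :=
    (one_div_pos.2 (Real.sqrt_pos.2 (Real.Gamma_pos_of_pos hα0))).ne'
  have hdense : Dense ((Submodule.span ℝ {g : Lp ℝ 2 volPos | ∃ a b : ℝ, 0 < a ∧ a < b ∧
      (g : ℝ → ℝ) =ᵐ[volPos] hadamardM α (indIoo a b)} : Submodule ℝ (Lp ℝ 2 volPos)) :
        Set (Lp ℝ 2 volPos)) := by
    refine (dense_span_logPowLp_sub hγ1 hγ2 hc).mono (Submodule.span_mono ?_)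
    rintro g ⟨a, b, ha, hab, rfl⟩
    exact ⟨a, b, ha, hab, (hadamardM_indIoo hα hγ1 hab).2⟩
  refine ⟨fun a b _ hab => ?_, hdense.mono (Submodule.span_mono ?_), hdense, fun f hf => ?_⟩
  · have h := hadamardM_indIoo hα hγ1 hab
    exact ⟨h.1, (memLp_congr_ae h.2).1 (Lp.memLp _)⟩
  · rintro g ⟨a, b, ha, hab, hg⟩
    exact ⟨a, b, ha.le, hab, hg⟩
  set v : ℝ≥0 → Lp ℝ 2 volPos := fun t => logPowLp hγ1 (1 / √(Real.Gamma α)) t with hv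
  set g : Lp ℝ 2 volPos := hf.memLp.toLp with hg
  have hstep := hadamardM_stepFunction hα hγ1
  -- `M^α_-` maps `φ n - f` to the step sum of `v` minus `g`, so the seminorm is an `L₂` distance.
  have key : ∀ φ : ℕ → StepFunction,
      TendstoHadamardL2 α φ f ↔ Tendsto (fun n => (φ n).sum v) atTop (𝓝 g) := fun φ =>
    tendsto_eLpNorm_sub_iff fun n => by
      have h := ((hstep (φ n)).1.linearCombination 1 (-1) hf.defined).2
      simp only [one_mul, neg_one_mul, ← sub_eq_add_neg] at h
      exact (coeFn_sub_ae_eq (hstep (φ n)).2 hf.memLp.coeFn_toLp).trans h.symm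
  constructor
  · obtain ⟨φ, hφ⟩ := exists_stepFunction_tendsto (v := v) (logPowLp_zero_right _ _)
      (dense_span_range_logPowLp hγ1 hγ2 hc) g
    exact ⟨φ, fun n => ⟨(hstep (φ n)).1, (memLp_congr_ae (hstep (φ n)).2).1 (Lp.memLp _)⟩,
      (key φ).2 hφ⟩
  intro Ω _ P _ B X hB hX
  obtain ⟨b, hb, U, hU⟩ := exists_wienerIsometry hB
  have hI := fun I : Lp ℝ 2 P =>
    isWienerIntegral_iff hb hU hf.memLp.coeFn_toLp (Filter.EventuallyEq.refl (ae P) I)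
  -- Uniqueness needs only the first property, which already forces `I = U g`.
  refine ⟨U g, ⟨(hI (U g)).2 rfl, fun φ hφ => ?_⟩, fun I hI' => ((hI I).1 hI'.1).symm⟩
  refine (tendsto_eLpNorm_sub_iff fun n => coeFn_sub_ae_eq ?_ Filter.EventuallyEq.rfl).2
    ((U.continuous.tendsto g).comp ((key φ).1 hφ))
  have := (φ n).map_sum U.toLinearMap v
  simp only [ContinuousLinearMap.coe_coe] at this
  simp only [Function.comp_apply, this]
  exact coeFn_stepFunction_sum (fun t => isHadamardFBM_ae_eq hγ1 hb hU hX t) (φ n)
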